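/- Let $G=(V,E)$ be a finite connected undirected simple graph, let $c\colon E\to\mathbb{R}$ be edge costs and $\mu\ge 0$, and give each edge the weight $w(e)=\exp(-\mu c(e))$, with $w(\{u,v\})=0$ if $\{u,v\}\notin E$. Let $s_1\neq s_2$ be two nodes (the seeds). Probabilistic Watershed. For $u,v\in V$ let $\mathcal{F}_{u}^{v}$ be the set of spanning forests of $G$ that consist of exactly two trees and have $u$ and $v$ in different trees, and let $\mathcal{F}_{u,q}^{v}=\mathcal{F}_{u}^{v}\cap\mathcal{F}_{q}^{v}$. For $f\in\mathcal{F}_{s_1}^{s_2}$ let $c(f)$ be the sum of the costs of the edges of $f$, and define the Gibbs distribution $P(f)=\exp(-\mu c(f))\big/\sum_{f'\in\mathcal{F}_{s_1}^{s_2}}\exp(-\mu c(f'))$. For $q\in V$ put $$P(q\sim s_1)=\sum_{f\in\mathcal{F}_{s_1,q}^{s_2}}P(f).$$ Random Walker. Consider the random walk on $V$ that moves from $v$ to $u$ with probability $w(\{v,u\})/\sum_{k\in V}w(\{v,k\})$, and let $x_q^{s_1}$ be the probability that this walk, started at $q$, reaches $s_1$ before reaching $s_2$. Let $L$ be the weighted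 Laplacian of $G$, that is, $L_{uv}=-w(\{u,v\})$ for $u\ne v$ and $L_{uu}=\sum_{k\in V}w(\{u,k\})$. Let $U=V\setminus\{s_1,s_2\}$, let $L_U$ be the submatrix of $L$ with rows and columns in $U$, and let $B=(L_{us_1})_{u\in U}$. Then for every $q\in V$ $$x_q^{s_1}=P(q\sim s_1).$$ Moreover, the vector $y=(P(q\sim s_1))_{q\in V}$ is the unique $y\in\mathbb{R}^V$ that satisfies $y_{s_1}=1$, $y_{s_2}=0$ and the Random Walker's linear system $L_U\,y_U=-B$. -/

import Mathlib

namespace ProbWatershed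

open MeasureTheory ProbabilityTheory
open scoped ENNReal Matrix

noncomputable section

variable {V : Type*}

/-! ### Weights and the Laplacian -/

/-- The edge weight `w(e) = exp(-μ c(e))` of an edge of cost `c e`. -/
def edgeWeight (c : Sym2 V → ℝ) (μ : ℝ) (e : Sym2 V) : ℝ :=
  Real.exp (-μ * c e)

open Classical in
/-- The weight `w({u,v})`, extended by `0` to the pairs that are not edges of `G`. -/
def pairWeight (G : SimpleGraph V) (w : Sym2 V → ℝ) (u v : V) : ℝ :=
  if G.Adj u v then w s(u, v) else 0

open Classical in
/-- The weighted Laplacian of `G`. -/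
def laplacian [Fintype V] (G : SimpleGraph V) (w : Sym2 V → ℝ) : Matrix V V ℝ :=
  Matrix.of fun u v =>
    if u = v then ∑ k, pairWeight G w u k else -pairWeight G w u v

/-! ### The Probabilistic Watershed -/

/-- The spanning forests of `G` with exactly two trees, such that `u` and `v` lie in different
trees. A spanning subgraph of `G` is a graph on the same vertex type below `G`. -/
def twoForests (G : SimpleGraph V) (u v : V) : Set (SimpleGraph V) :=
  {f | f ≤ G ∧ f.IsAcyclic ∧ Nat.card f.ConnectedComponent = 2 ∧ ¬ f.Reachable u v}

/-- The 2-forests with `u` and `q` in one tree and `v` in the other one. -/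
def twoForestsThree (G : SimpleGraph V) (u q v : V) : Set (SimpleGraph V) :=
  twoForests G u v ∩ twoForests G q v

open Classical in
/-- The cost of a graph: the sum of the costs of its edges. -/
def graphCost [Fintype V] (c : Sym2 V → ℝ) (f : SimpleGraph V) : ℝ :=
  ∑ e ∈ f.edgeFinset, c e

open Classical in
/-- The Gibbs probability of the 2-forest `f` among the 2-forests that separate `s₁` and `s₂`. -/
def gibbs [Fintype V] (G : SimpleGraph V) (c : Sym2 V → ℝ) (μ : ℝ) (s₁ s₂ : V)
    (f : SimpleGraph V) : ℝ :=
  Real.exp (-μ * graphCost c f) /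
    ∑ f' ∈ (twoForests G s₁ s₂).toFinset, Real.exp (-μ * graphCost c f')

open Classical in
/-- The Probabilistic Watershed probability `P(q ∼ s₁)`: the Gibbs probability of sampling a
2-forest that separates the seeds and connects `q` with `s₁`. -/
def watershedProb [Fintype V] (G : SimpleGraph V) (c : Sym2 V → ℝ) (μ : ℝ) (s₁ s₂ q : V) : ℝ :=
  ∑ f ∈ (twoForestsThree G s₁ q s₂).toFinset, gibbs G c μ s₁ s₂ f

/-! ### The random walk on the weighted graph -/

/-- One step of the random walk from `v`: move to `u` with probability proportional to the weight
`w({v,u})`. A vertex without an edge of positive weight (there is none in a connected graph with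
two vertices and positive weights) is absorbing. -/
def stepPMF [Fintype V] (G : SimpleGraph V) (w : Sym2 V → ℝ) (v : V) : PMF V :=
  open Classical in
  if h : ∑' u, ENNReal.ofReal (pairWeight G w v u) = 0 then PMF.pure v
  else PMF.normalize (fun u => ENNReal.ofReal (pairWeight G w v u)) h
    (by rw [tsum_fintype]; exact ENNReal.sum_ne_top.2 fun _ _ => ENNReal.ofReal_ne_top)

/-- The transition kernel from the path up to time `n` to the position at time `n + 1`; it depends
on the path through its last position only. -/
def stepKernel [Fintype V] [MeasurableSpace V] [MeasurableSingletonClass V]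
    (G : SimpleGraph V) (w : Sym2 V → ℝ) (n : ℕ) : Kernel (Finset.Iic n → V) V where
  toFun p := (stepPMF G w (p ⟨n, Finset.mem_Iic.2 le_rfl⟩)).toMeasure
  measurable' := measurable_of_countable _

instance [Fintype V] [MeasurableSpace V] [MeasurableSingletonClass V]
    (G : SimpleGraph V) (w : Sym2 V → ℝ) (n : ℕ) : IsMarkovKernel (stepKernel G w n) :=
  ⟨fun _ => PMF.toMeasure.isProbabilityMeasure _⟩

/-- The law, on the space `ℕ → V` of trajectories, of the random walk started at `q`. -/
def walkLaw [Fintype V] [MeasurableSpace V] [MeasurableSingletonClass V]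
    (G : SimpleGraph V) (w : Sym2 V → ℝ) (q : V) : Measure (ℕ → V) :=
  Kernel.traj (X := fun _ => V) (stepKernel G w) 0 (fun _ => q)

/-- The probability that the random walk started at `q` reaches `s₁` before reaching `s₂`. -/
def hitProb [Fintype V] [MeasurableSpace V] [MeasurableSingletonClass V]
    (G : SimpleGraph V) (w : Sym2 V → ℝ) (s₁ s₂ q : V) : ℝ :=
  (walkLaw G w q).real {ω | ∃ n, ω n = s₁ ∧ ∀ m ≤ n, ω m ≠ s₂}

/-! ### The linear system of the Random Walker -/

/-- The unseeded vertices. -/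
abbrev Unseeded (s₁ s₂ : V) : Type _ := {v : V // v ≠ s₁ ∧ v ≠ s₂}

open Classical in
/-- `x` solves the Random Walker's Dirichlet problem with the boundary values `1` at `s₁` and `0`
at `s₂`: `L_U x_U = -B`, where `L_U` is the block of the Laplacian on the unseeded vertices and
`B` is the column of `s₁` in the unseeded rows. -/
def IsRandomWalkerSolution [Fintype V] (G : SimpleGraph V) (w : Sym2 V → ℝ) (s₁ s₂ : V)
    (x : V → ℝ) : Prop :=
  x s₁ = 1 ∧ x s₂ = 0 ∧
    (laplacian G w).submatrix (Subtype.val : Unseeded s₁ s₂ → V) Subtype.val *ᵥ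
        (fun u : Unseeded s₁ s₂ => x u) =
      -(fun u : Unseeded s₁ s₂ => laplacian G w u s₁)

end

end ProbWatershed

/-!
Deleting an edge `qk` from a spanning tree whose path from `s` to `t` runs through `q` and then `k`
leaves a two-forest with `s`, `q` in one tree and `t`, `k` in the other, and every such two-forest
arises once. Hence the sum over `k` of `w(qk)` times the total weight of these two-forests is the
total weight of the spanning trees whose `s`-`t` path passes through `q`, which is symmetric in `s`
and `t`. This symmetry says exactly that the watershed probabilities are harmonic off the seeds.
The hitting probabilities are harmonic off the seeds by conditioning on the first step of the walk,
both families have the same values at the seeds, and the maximum principle identifies them.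
-/

namespace ProbWatershed

open MeasureTheory ProbabilityTheory
open scoped ENNReal Matrix

noncomputable section

variable {V : Type*}

/-! ### Separation in trees -/

section Separation

variable {G T : SimpleGraph V} {q s t k l v : V}

theorem reachable_deleteIncidenceSet (h : G.Reachable v k) (hq : ¬ G.Reachable q k) :
    (G.deleteIncidenceSet q).Reachable v k := by
  obtain ⟨p⟩ := h
  induction p with
  | nil => rfl
  | @cons u v k huv p ih =>
    have hu : u ≠ q := fun h => hq (h ▸ huv.reachable.trans p.reachable)
    have hv : v ≠ q := fun h => hq (h ▸ p.reachable)
    exact (SimpleGraph.deleteIncidenceSet_adj.2 ⟨huv, hu, hv⟩).reachable.trans (ih hq)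

theorem exists_adj_reachable_deleteIncidenceSet (h : G.Reachable t q) (hqt : q ≠ t) :
    ∃ k, G.Adj q k ∧ (G.deleteIncidenceSet q).Reachable t k := by
  obtain ⟨p⟩ := h
  induction p with
  | nil => exact absurd rfl hqt
  | @cons t v q htv p ih =>
    obtain rfl | hqv := eq_or_ne q v
    · exact ⟨t, htv.symm, .rfl⟩
    · obtain ⟨k, hqk, hvk⟩ := ih hqv
      exact ⟨k, hqk,
        (SimpleGraph.deleteIncidenceSet_adj.2 ⟨htv, hqt.symm, hqv.symm⟩).reachable.trans hvk⟩

theorem deleteIncidenceSet_le_deleteEdges :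
    G.deleteIncidenceSet q ≤ G.deleteEdges {s(q, k)} := by
  intro u v h
  obtain ⟨huv, hu, hv⟩ := SimpleGraph.deleteIncidenceSet_adj.1 h
  refine SimpleGraph.deleteEdges_adj.2 ⟨huv, fun he => ?_⟩
  obtain ⟨rfl, -⟩ | ⟨-, rfl⟩ := Sym2.eq_iff.1 he
  exacts [hu rfl, hv rfl]

theorem not_reachable_deleteEdges (hT : T.IsAcyclic) (h : T.Adj q k) :
    ¬ (T.deleteEdges {s(q, k)}).Reachable q k :=
  SimpleGraph.isBridge_iff.1 (SimpleGraph.isAcyclic_iff_forall_adj_isBridge.1 hT h)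

theorem reachable_deleteEdges_right_iff (hT : T.IsAcyclic) (h : T.Adj q k) :
    (T.deleteEdges {s(q, k)}).Reachable v k ↔ (T.deleteIncidenceSet q).Reachable v k := by
  refine ⟨fun hv => ?_, .mono deleteIncidenceSet_le_deleteEdges⟩
  refine (reachable_deleteIncidenceSet hv (not_reachable_deleteEdges hT h)).mono ?_
  intro a b hab
  simp only [SimpleGraph.deleteIncidenceSet_adj, SimpleGraph.deleteEdges_adj] at hab ⊢
  exact ⟨hab.1.1, hab.2⟩

theorem eq_of_reachable_deleteIncidenceSet (hT : T.IsAcyclic) (hk : T.Adj q k) (hl : T.Adj q l)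
    (h : (T.deleteIncidenceSet q).Reachable k l) : k = l := by
  by_contra hkl
  have hqk : (T.deleteEdges {s(q, l)}).Adj q k :=
    SimpleGraph.deleteEdges_adj.2 ⟨hk, fun he => hkl (Sym2.congr_right.1 he)⟩
  exact not_reachable_deleteEdges hT hl
    (hqk.reachable.trans (h.mono deleteIncidenceSet_le_deleteEdges))

theorem reachable_deleteEdges_or (hG : G.Reachable v q) :
    (G.deleteEdges {s(q, k)}).Reachable v q ∨ (G.deleteEdges {s(q, k)}).Reachable v k := by
  obtain ⟨p⟩ := hG
  induction p with
  | nil => exact .inl .rfl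
  | @cons u v q huv p ih =>
    by_cases he : s(u, v) = s(q, k)
    · obtain ⟨rfl, -⟩ | ⟨rfl, -⟩ := Sym2.eq_iff.1 he
      exacts [.inl .rfl, .inr .rfl]
    · have huv' : (G.deleteEdges {s(q, k)}).Adj u v := SimpleGraph.deleteEdges_adj.2 ⟨huv, he⟩
      exact ih.imp huv'.reachable.trans huv'.reachable.trans

theorem reachable_deleteEdges_left_iff (hT : T.IsTree) (h : T.Adj q k) :
    (T.deleteEdges {s(q, k)}).Reachable v q ↔ ¬ (T.deleteEdges {s(q, k)}).Reachable v k :=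
  ⟨fun hq hk => not_reachable_deleteEdges hT.isAcyclic h (hq.symm.trans hk),
    (reachable_deleteEdges_or (hT.connected v q)).resolve_right⟩

end Separation

/-- The spanning trees of `G` in which the vertex `q` lies on the path from `s` to `t`, that is,
in which removing the edges at `q` disconnects `s` from `t`. -/
def treesThroughVertex (G : SimpleGraph V) (s q t : V) : Set (SimpleGraph V) :=
  {T | T ≤ G ∧ T.IsTree ∧ ¬ (T.deleteIncidenceSet q).Reachable s t}

/-- The spanning trees of `G` in which the path from `s` to `t` runs through the edge `qk`, in the
direction from `q` to `k`. -/
def treesThroughEdge (G : SimpleGraph V) (s q k t : V) : Set (SimpleGraph V) :=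
  {T | T ≤ G ∧ T.IsTree ∧ T.Adj q k ∧ (T.deleteEdges {s(q, k)}).Reachable s q ∧
    (T.deleteEdges {s(q, k)}).Reachable t k}

section Trees

variable {G T : SimpleGraph V} {q s t k : V}

theorem treesThroughVertex_comm (G : SimpleGraph V) (s q t : V) :
    treesThroughVertex G s q t = treesThroughVertex G t q s := by
  simp only [treesThroughVertex, SimpleGraph.reachable_comm (u := s) (v := t)]

theorem mem_treesThroughEdge_iff : T ∈ treesThroughEdge G s q k t ↔
    T ∈ treesThroughVertex G s q t ∧ T.Adj q k ∧ (T.deleteIncidenceSet q).Reachable t k := by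
  have key (hT : T.IsTree) (hqk : T.Adj q k) :
      (T.deleteEdges {s(q, k)}).Reachable s q ∧ (T.deleteEdges {s(q, k)}).Reachable t k ↔
        ¬ (T.deleteIncidenceSet q).Reachable s t ∧ (T.deleteIncidenceSet q).Reachable t k := by
    rw [reachable_deleteEdges_left_iff hT hqk, reachable_deleteEdges_right_iff hT.isAcyclic hqk,
      reachable_deleteEdges_right_iff hT.isAcyclic hqk]
    exact and_congr_left fun htk => not_congr ⟨(·.trans htk.symm), (·.trans htk)⟩
  constructor
  · rintro ⟨hle, hT, hqk, h⟩
    exact ⟨⟨hle, hT, ((key hT hqk).1 h).1⟩, hqk, ((key hT hqk).1 h).2⟩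
  · rintro ⟨⟨hle, hT, hst⟩, hqk, htk⟩
    exact ⟨hle, hT, hqk, (key hT hqk).2 ⟨hst, htk⟩⟩

theorem treesThroughVertex_eq_iUnion (hqt : q ≠ t) :
    treesThroughVertex G s q t = ⋃ k ∈ G.neighborSet q, treesThroughEdge G s q k t := by
  ext T
  simp only [Set.mem_iUnion, mem_treesThroughEdge_iff, exists_prop]
  refine ⟨fun hT => ?_, fun ⟨_, _, hT, _⟩ => hT⟩
  obtain ⟨k, hqk, htk⟩ :=
    exists_adj_reachable_deleteIncidenceSet (hT.2.1.connected t q) hqt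
  exact ⟨k, hT.1 hqk, hT, hqk, htk⟩

theorem pairwise_disjoint_treesThroughEdge (G : SimpleGraph V) (s q t : V) :
    Pairwise (Function.onFun Disjoint fun k => treesThroughEdge G s q k t) := by
  intro k l hkl
  refine Set.disjoint_left.2 fun T hk hl => hkl ?_
  obtain ⟨hT, hqk, htk⟩ := mem_treesThroughEdge_iff.1 hk
  obtain ⟨-, hql, htl⟩ := mem_treesThroughEdge_iff.1 hl
  exact eq_of_reachable_deleteIncidenceSet hT.2.1.isAcyclic hqk hql (htk.symm.trans htl)

end Trees

/-! ### Two-forests -/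

/-- The two-forests with `s` and `a` in one tree, `t` and `b` in the other. -/
def twoForestsSplit (G : SimpleGraph V) (s a t b : V) : Set (SimpleGraph V) :=
  {f | f ∈ twoForests G s t ∧ f.Reachable s a ∧ f.Reachable t b}

section TwoForests

variable {G f T : SimpleGraph V} {s t q a b k : V}

theorem mem_twoForests_iff : f ∈ twoForests G s t ↔
    f ≤ G ∧ f.IsAcyclic ∧ ¬ f.Reachable s t ∧ ∀ x, f.Reachable s x ∨ f.Reachable t x := by
  refine and_congr_right fun _ => and_congr_right fun _ => ?_
  rw [and_comm]
  refine and_congr_right fun hst => ?_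
  have hne : f.connectedComponentMk s ≠ f.connectedComponentMk t := by
    rwa [ne_eq, SimpleGraph.ConnectedComponent.eq]
  rw [Nat.card_eq_two_iff' (f.connectedComponentMk s)]
  constructor
  · rintro ⟨y, -, hy⟩ x
    refine or_iff_not_imp_left.2 fun hx => SimpleGraph.ConnectedComponent.eq.1 ?_
    exact (hy _ hne.symm).trans
      (hy _ fun h => hx (SimpleGraph.ConnectedComponent.eq.1 h.symm)).symm
  · refine fun h => ⟨f.connectedComponentMk t, hne.symm, fun y => ?_⟩
    refine y.ind fun x hx => SimpleGraph.ConnectedComponent.eq.2 ?_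
    exact ((h x).resolve_left fun h' => hx (SimpleGraph.ConnectedComponent.eq.2 h'.symm)).symm

theorem twoForests_comm (G : SimpleGraph V) (s t : V) : twoForests G s t = twoForests G t s := by
  simp only [twoForests, SimpleGraph.reachable_comm (u := s) (v := t)]

theorem not_reachable_left_iff (hf : f ∈ twoForests G s t) (x : V) :
    ¬ f.Reachable s x ↔ f.Reachable t x := by
  obtain ⟨-, -, hst, hx⟩ := mem_twoForests_iff.1 hf
  exact ⟨(hx x).resolve_left, fun h h' => hst (h'.trans h.symm)⟩

theorem deleteEdges_mem_twoForestsSplit (hT : T ∈ treesThroughEdge G s a b t) :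
    T.deleteEdges {s(a, b)} ∈ twoForestsSplit G s a t b := by
  obtain ⟨hle, hT, hab, hsa, htb⟩ := hT
  refine ⟨mem_twoForests_iff.2 ⟨(SimpleGraph.deleteEdges_le _).trans hle,
    hT.isAcyclic.anti (SimpleGraph.deleteEdges_le _), fun hst =>
      not_reachable_deleteEdges hT.isAcyclic hab (hsa.symm.trans (hst.trans htb)),
    fun x => ?_⟩, hsa, htb⟩
  exact (reachable_deleteEdges_or (hT.connected x a)).imp
    (fun h => hsa.trans h.symm) (fun h => htb.trans h.symm)

theorem not_reachable_of_mem_twoForestsSplit (hf : f ∈ twoForestsSplit G s a t b) :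
    ¬ f.Reachable a b :=
  fun h => hf.1.2.2.2 (hf.2.1.trans (h.trans hf.2.2.symm))

theorem isTree_sup_edge (hf : f ∈ twoForestsSplit G s a t b) :
    (f ⊔ SimpleGraph.edge a b).IsTree := by
  have hab := not_reachable_of_mem_twoForestsSplit hf
  obtain ⟨hst, hsa, htb⟩ := hf
  obtain ⟨-, hf, -, hcov⟩ := mem_twoForests_iff.1 hst
  have hadj : (f ⊔ SimpleGraph.edge a b).Adj a b :=
    .inr ((SimpleGraph.adj_edge _ _).2 ⟨rfl, fun h => hab (h ▸ .rfl)⟩)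
  have ha (x : V) : (f ⊔ SimpleGraph.edge a b).Reachable a x := (hcov x).elim
    (fun h => (hsa.symm.trans h).mono le_sup_left)
    (fun h => hadj.reachable.trans ((htb.symm.trans h).mono le_sup_left))
  have : Nonempty V := ⟨a⟩
  exact ⟨⟨fun x y => (ha x).symm.trans (ha y)⟩, hf.sup_edge_of_not_reachable hab⟩

theorem sup_edge_deleteEdges (hab : ¬ f.Adj a b) :
    (f ⊔ SimpleGraph.edge a b).deleteEdges {s(a, b)} = f :=
  ((f.disjoint_edge).2 hab).sup_sdiff_cancel_right

theorem deleteEdges_sup_edge (hab : T.Adj a b) :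
    T.deleteEdges {s(a, b)} ⊔ SimpleGraph.edge a b = T :=
  sdiff_sup_cancel ((SimpleGraph.edge_le_iff T).2 (.inr hab))

theorem sup_edge_mem_treesThroughEdge (hab : G.Adj a b) (hf : f ∈ twoForestsSplit G s a t b) :
    f ⊔ SimpleGraph.edge a b ∈ treesThroughEdge G s a b t := by
  have hfab : ¬ f.Adj a b := fun h => not_reachable_of_mem_twoForestsSplit hf h.reachable
  refine ⟨sup_le hf.1.1 ?_, isTree_sup_edge hf,
    .inr ((SimpleGraph.adj_edge _ _).2 ⟨rfl, hab.ne⟩), ?_⟩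
  · exact (SimpleGraph.edge_le_iff _).2 (.inr hab)
  · rw [sup_edge_deleteEdges hfab]
    exact hf.2

theorem nonempty_twoForests (hG : G.Connected) (hst : s ≠ t) : (twoForests G s t).Nonempty := by
  obtain ⟨T, hle, hT⟩ := hG.exists_isTree_le
  obtain ⟨k, hsk, htk⟩ := exists_adj_reachable_deleteIncidenceSet (hT.connected t s) hst
  exact ⟨_, (deleteEdges_mem_twoForestsSplit ⟨hle, hT, hsk, .rfl,
    htk.mono deleteIncidenceSet_le_deleteEdges⟩).1⟩

theorem mem_twoForestsThree_iff :
    f ∈ twoForestsThree G s q t ↔ f ∈ twoForests G s t ∧ f.Reachable s q := by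
  refine and_congr_right fun hst => ⟨fun hqt => ?_, fun hsq => ?_⟩
  · by_contra h
    exact hqt.2.2.2 ((not_reachable_left_iff hst q).1 h).symm
  · exact ⟨hst.1, hst.2.1, hst.2.2.1, fun hqt => hst.2.2.2 (hsq.trans hqt)⟩

theorem twoForestsSplit_eq_diff (G : SimpleGraph V) (s q t k : V) :
    twoForestsSplit G s q t k = twoForestsThree G s q t \ twoForestsThree G s k t := by
  ext f
  simp only [Set.mem_sdiff, mem_twoForestsThree_iff, not_and]
  exact ⟨fun ⟨hf, hq, hk⟩ => ⟨⟨hf, hq⟩, fun _ => (not_reachable_left_iff hf k).2 hk⟩,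
    fun ⟨⟨hf, hq⟩, hk⟩ => ⟨hf, hq, (not_reachable_left_iff hf k).1 (hk hf)⟩⟩

theorem twoForestsSplit_comm (G : SimpleGraph V) (s q t k : V) :
    twoForestsSplit G s q t k = twoForestsSplit G t k s q := by
  simp only [twoForestsSplit, twoForests_comm G s t, and_comm (a := SimpleGraph.Reachable _ s q)]

end TwoForests

/-! ### Weighted sums over spanning subgraphs -/

section Weights

variable [Fintype V] {R : Type*} [CommSemiring R]

open Classical in
/-- The weight of a graph: the product of the weights of its edges. -/
def graphWeight (w : Sym2 V → R) (f : SimpleGraph V) : R :=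
  ∏ e ∈ f.edgeFinset, w e

open Classical in
/-- The total weight of a set of graphs on `V`, the partition function of its Gibbs measure. -/
def totalWeight (w : Sym2 V → R) (S : Set (SimpleGraph V)) : R :=
  ∑ f ∈ S.toFinset, graphWeight w f

theorem graphWeight_eq_mul_deleteEdges (w : Sym2 V → R) {T : SimpleGraph V} {a b : V}
    (hab : T.Adj a b) :
    graphWeight w T = w s(a, b) * graphWeight w (T.deleteEdges {s(a, b)}) := by
  classical
  have h : (T.deleteEdges {s(a, b)}).edgeFinset = T.edgeFinset.erase s(a, b) := by
    ext e
    simp [and_comm]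
  rw [graphWeight, graphWeight, ← Finset.mul_prod_erase T.edgeFinset w
    (SimpleGraph.mem_edgeFinset.2 (T.mem_edgeSet.2 hab))]
  congr! 2
  convert h.symm

theorem totalWeight_pos {w : Sym2 V → ℝ} {S : Set (SimpleGraph V)} (hS : S.Nonempty)
    (hw : ∀ f ∈ S, ∀ e ∈ f.edgeSet, 0 < w e) : 0 < totalWeight w S := by
  classical
  exact Finset.sum_pos (fun f hf => Finset.prod_pos fun e he =>
    hw f (Set.mem_toFinset.1 hf) e (SimpleGraph.mem_edgeFinset.1 he)) (Set.toFinset_nonempty.2 hS)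

theorem totalWeight_inter_add_sdiff (w : Sym2 V → R) (S S' : Set (SimpleGraph V)) :
    totalWeight w (S ∩ S') + totalWeight w (S \ S') = totalWeight w S := by
  classical
  simp only [totalWeight, Set.toFinset_inter, Set.toFinset_sdiff]
  exact Finset.sum_inter_add_sum_sdiff ..

theorem totalWeight_biUnion {ι : Type*} (w : Sym2 V → R) (A : Finset ι)
    {S : ι → Set (SimpleGraph V)} (hS : Pairwise (Function.onFun Disjoint S)) :
    totalWeight w (⋃ k ∈ A, S k) = ∑ k ∈ A, totalWeight w (S k) := by
  classical
  calc totalWeight w (⋃ k ∈ A, S k)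
      = ∑ f ∈ A.biUnion fun k => (S k).toFinset, graphWeight w f :=
        Finset.sum_congr (by ext; simp) fun _ _ => rfl
    _ = ∑ k ∈ A, totalWeight w (S k) :=
        Finset.sum_biUnion fun k _ l _ hkl => Set.disjoint_toFinset.2 (hS hkl)

theorem totalWeight_treesThroughEdge {G : SimpleGraph V} (w : Sym2 V → R) (s t : V) {a b : V}
    (hab : G.Adj a b) :
    totalWeight w (treesThroughEdge G s a b t) =
      w s(a, b) * totalWeight w (twoForestsSplit G s a t b) := by
  rw [totalWeight, totalWeight, Finset.mul_sum]
  refine Finset.sum_nbij' (·.deleteEdges {s(a, b)}) (· ⊔ SimpleGraph.edge a b) ?_ ?_ ?_ ?_ ?_ <;>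
    simp only [Set.mem_toFinset]
  · exact fun T hT => deleteEdges_mem_twoForestsSplit hT
  · exact fun f hf => sup_edge_mem_treesThroughEdge hab hf
  · exact fun T hT => deleteEdges_sup_edge hT.2.2.1
  · exact fun f hf => sup_edge_deleteEdges fun h =>
      not_reachable_of_mem_twoForestsSplit hf h.reachable
  · exact fun T hT => graphWeight_eq_mul_deleteEdges w hT.2.2.1

open Classical in
theorem sum_mul_totalWeight_twoForestsSplit (G : SimpleGraph V) (w : Sym2 V → R) (s : V)
    {q t : V} (hqt : q ≠ t) :
    ∑ k ∈ G.neighborFinset q, w s(q, k) * totalWeight w (twoForestsSplit G s q t k) =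
      totalWeight w (treesThroughVertex G s q t) := by
  have h : treesThroughVertex G s q t = ⋃ k ∈ G.neighborFinset q, treesThroughEdge G s q k t := by
    simpa using treesThroughVertex_eq_iUnion hqt
  rw [h, totalWeight_biUnion w _ (pairwise_disjoint_treesThroughEdge G s q t)]
  exact Finset.sum_congr rfl fun k hk =>
    (totalWeight_treesThroughEdge w s t ((G.mem_neighborFinset q k).1 hk)).symm

open Classical in
theorem sum_mul_totalWeight_twoForestsSplit_comm (G : SimpleGraph V) (w : Sym2 V → R) {s q t : V}
    (hqs : q ≠ s) (hqt : q ≠ t) :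
    ∑ k ∈ G.neighborFinset q, w s(q, k) * totalWeight w (twoForestsSplit G s q t k) =
      ∑ k ∈ G.neighborFinset q, w s(q, k) * totalWeight w (twoForestsSplit G s k t q) := by
  rw [sum_mul_totalWeight_twoForestsSplit G w s hqt, treesThroughVertex_comm,
    ← sum_mul_totalWeight_twoForestsSplit G w t hqs]
  simp only [twoForestsSplit_comm G t q s]

theorem totalWeight_twoForestsThree_add (G : SimpleGraph V) (w : Sym2 V → R) (s t q k : V) :
    totalWeight w (twoForestsThree G s q t) + totalWeight w (twoForestsSplit G s k t q) =
      totalWeight w (twoForestsThree G s k t) + totalWeight w (twoForestsSplit G s q t k) := by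
  rw [twoForestsSplit_eq_diff, twoForestsSplit_eq_diff,
    ← totalWeight_inter_add_sdiff w (twoForestsThree G s q t) (twoForestsThree G s k t),
    ← totalWeight_inter_add_sdiff w (twoForestsThree G s k t) (twoForestsThree G s q t),
    Set.inter_comm (twoForestsThree G s k t)]
  ac_rfl

end Weights

/-! ### The Dirichlet problem -/

section Dirichlet

variable {G : SimpleGraph V} {w : Sym2 V → ℝ} {S : Set V} {s₁ s₂ : V}

theorem pairWeight_nonneg (hw : ∀ e ∈ G.edgeSet, 0 < w e) (u v : V) : 0 ≤ pairWeight G w u v := by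
  unfold pairWeight
  split_ifs with h
  exacts [(hw _ h).le, le_rfl]

variable [Fintype V]

open Classical in
theorem sum_pairWeight_mul (G : SimpleGraph V) (w : Sym2 V → ℝ) (u : V) (g : V → ℝ) :
    ∑ k, pairWeight G w u k * g k = ∑ k ∈ G.neighborFinset u, w s(u, k) * g k := by
  simp [pairWeight, SimpleGraph.neighborFinset_eq_filter, Finset.sum_filter]

theorem laplacian_mulVec (G : SimpleGraph V) (w : Sym2 V → ℝ) (x : V → ℝ) (u : V) :
    (laplacian G w *ᵥ x) u = ∑ k, pairWeight G w u k * (x u - x k) := by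
  classical
  have hL (k : V) : laplacian G w u k * x k =
      (if u = k then (∑ j, pairWeight G w u j) * x u else 0) - pairWeight G w u k * x k := by
    rcases eq_or_ne u k with rfl | huk
    · simp [laplacian, pairWeight]
    · simp [laplacian, huk]
  simp only [Matrix.mulVec, dotProduct, hL, mul_sub, Finset.sum_sub_distrib, Finset.sum_mul,
    Finset.sum_ite_eq, Finset.mem_univ, if_true]

theorem exists_mem_forall_le_of_laplacian_mulVec_nonpos (hG : G.Connected)
    (hw : ∀ e ∈ G.edgeSet, 0 < w e) (hS : S.Nonempty) {x : V → ℝ}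
    (hx : ∀ q ∉ S, (laplacian G w *ᵥ x) q ≤ 0) : ∃ s ∈ S, ∀ v, x v ≤ x s := by
  classical
  have := hG.nonempty
  obtain ⟨s, hs⟩ := hS
  obtain ⟨q, hq⟩ := Finite.exists_max x
  obtain ⟨p⟩ := hG q s
  induction p with
  | nil => exact ⟨_, hs, hq⟩
  | @cons u v s huv _ ih =>
    by_cases hu : u ∈ S
    · exact ⟨u, hu, hq⟩
    have hnonneg : ∀ k ∈ Finset.univ, 0 ≤ pairWeight G w u k * (x u - x k) := fun k _ =>
      mul_nonneg (pairWeight_nonneg hw u k) (sub_nonneg.2 (hq k))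
    have hsum := hx u hu
    rw [laplacian_mulVec] at hsum
    have hzero := (Finset.sum_eq_zero_iff_of_nonneg hnonneg).1
      (hsum.antisymm (Finset.sum_nonneg hnonneg)) v (Finset.mem_univ v)
    rw [pairWeight, if_pos huv] at hzero
    have hxuv : x u = x v := sub_eq_zero.1 ((mul_eq_zero.1 hzero).resolve_left (hw _ huv).ne')
    exact ih hs (hxuv ▸ hq)

theorem le_of_laplacian_mulVec_le (hG : G.Connected) (hw : ∀ e ∈ G.edgeSet, 0 < w e)
    (hS : S.Nonempty) {x y : V → ℝ} (hxy : ∀ s ∈ S, x s ≤ y s)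
    (hL : ∀ q ∉ S, (laplacian G w *ᵥ x) q ≤ (laplacian G w *ᵥ y) q) : x ≤ y := by
  obtain ⟨s, hs, hmax⟩ := exists_mem_forall_le_of_laplacian_mulVec_nonpos hG hw hS
    (x := x - y) fun q hq => by
      rw [Matrix.mulVec_sub]
      exact sub_nonpos.2 (hL q hq)
  exact fun v => sub_nonpos.1 ((hmax v).trans (sub_nonpos.2 (hxy s hs)))

theorem eq_of_laplacian_mulVec_eq (hG : G.Connected) (hw : ∀ e ∈ G.edgeSet, 0 < w e)
    (hS : S.Nonempty) {x y : V → ℝ} (hxy : ∀ s ∈ S, x s = y s)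
    (hL : ∀ q ∉ S, (laplacian G w *ᵥ x) q = (laplacian G w *ᵥ y) q) : x = y :=
  (le_of_laplacian_mulVec_le hG hw hS (fun s hs => (hxy s hs).le) fun q hq => (hL q hq).le).antisymm
    (le_of_laplacian_mulVec_le hG hw hS (fun s hs => (hxy s hs).ge) fun q hq => (hL q hq).ge)

theorem isRandomWalkerSolution_iff (hs : s₁ ≠ s₂) {x : V → ℝ} :
    IsRandomWalkerSolution G w s₁ s₂ x ↔
      x s₁ = 1 ∧ x s₂ = 0 ∧ ∀ q ∉ ({s₁, s₂} : Set V), (laplacian G w *ᵥ x) q = 0 := by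
  classical
  refine and_congr_right fun h₁ => and_congr_right fun h₂ => ?_
  have hsplit (u : Unseeded s₁ s₂) : (laplacian G w *ᵥ x) u =
      ((laplacian G w).submatrix (Subtype.val : Unseeded s₁ s₂ → V) Subtype.val *ᵥ
        fun v : Unseeded s₁ s₂ => x v) u + laplacian G w u s₁ := by
    rw [Matrix.mulVec, dotProduct, ← Finset.sum_add_sum_compl {s₁, s₂}, Finset.sum_pair hs, h₁, h₂,
      mul_one, mul_zero, add_zero, add_comm]
    congr 1
    exact Finset.sum_subtype _ (by simp) _
  calc _ ↔ ∀ u : Unseeded s₁ s₂, (laplacian G w *ᵥ x) u = 0 := by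
        rw [eq_neg_iff_add_eq_zero, funext_iff]
        exact forall_congr' fun u => by rw [hsplit]; rfl
    _ ↔ ∀ q ∉ ({s₁, s₂} : Set V), (laplacian G w *ᵥ x) q = 0 := by
        simp only [Subtype.forall, Set.mem_insert_iff, Set.mem_singleton_iff, not_or]

theorem IsRandomWalkerSolution.unique (hG : G.Connected) (hw : ∀ e ∈ G.edgeSet, 0 < w e)
    (hs : s₁ ≠ s₂) {x y : V → ℝ} (hx : IsRandomWalkerSolution G w s₁ s₂ x)
    (hy : IsRandomWalkerSolution G w s₁ s₂ y) : x = y := by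
  rw [isRandomWalkerSolution_iff hs] at hx hy
  refine eq_of_laplacian_mulVec_eq hG hw (Set.insert_nonempty s₁ {s₂}) ?_
    fun q hq => (hx.2.2 q hq).trans (hy.2.2 q hq).symm
  rintro s (rfl | rfl)
  exacts [hx.1.trans hy.1.symm, hx.2.1.trans hy.2.1.symm]

end Dirichlet

/-! ### The Probabilistic Watershed solves the Dirichlet problem -/

/-- The Probabilistic Watershed probability of `q` for arbitrary edge weights `w`: the share of the
two-forests separating `s₁` from `s₂` that connect `q` with `s₁`, each two-forest being counted
with the product of the weights of its edges. -/
def forestProb [Fintype V] (G : SimpleGraph V) (w : Sym2 V → ℝ) (s₁ s₂ q : V) : ℝ :=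
  totalWeight w (twoForestsThree G s₁ q s₂) / totalWeight w (twoForests G s₁ s₂)

section Watershed

variable [Fintype V] {G : SimpleGraph V} {w : Sym2 V → ℝ} {s₁ s₂ : V}

theorem graphWeight_edgeWeight (c : Sym2 V → ℝ) (μ : ℝ) (f : SimpleGraph V) :
    graphWeight (edgeWeight c μ) f = Real.exp (-μ * graphCost c f) := by
  simp only [graphWeight, edgeWeight, graphCost, Finset.mul_sum, Real.exp_sum]

theorem watershedProb_eq_forestProb (G : SimpleGraph V) (c : Sym2 V → ℝ) (μ : ℝ) (s₁ s₂ q : V) :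
    watershedProb G c μ s₁ s₂ q = forestProb G (edgeWeight c μ) s₁ s₂ q := by
  simp only [watershedProb, gibbs, forestProb, totalWeight, graphWeight_edgeWeight, Finset.sum_div]

theorem laplacian_mulVec_totalWeight (G : SimpleGraph V) (w : Sym2 V → ℝ) {s t q : V}
    (hqs : q ≠ s) (hqt : q ≠ t) :
    (laplacian G w *ᵥ fun v => totalWeight w (twoForestsThree G s v t)) q = 0 := by
  classical
  have hdiff (k : V) : totalWeight w (twoForestsThree G s q t) -
      totalWeight w (twoForestsThree G s k t) = totalWeight w (twoForestsSplit G s q t k) -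
        totalWeight w (twoForestsSplit G s k t q) := by
    linear_combination totalWeight_twoForestsThree_add G w s t q k
  rw [laplacian_mulVec, sum_pairWeight_mul]
  simp only [hdiff, mul_sub, Finset.sum_sub_distrib]
  exact sub_eq_zero.2 (sum_mul_totalWeight_twoForestsSplit_comm G w hqs hqt)

theorem isRandomWalkerSolution_forestProb (hG : G.Connected) (hw : ∀ e ∈ G.edgeSet, 0 < w e)
    (hs : s₁ ≠ s₂) : IsRandomWalkerSolution G w s₁ s₂ (forestProb G w s₁ s₂) := by
  have hpos : 0 < totalWeight w (twoForests G s₁ s₂) :=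
    totalWeight_pos (nonempty_twoForests hG hs) fun f hf e he =>
      hw e (SimpleGraph.edgeSet_mono hf.1 he)
  refine (isRandomWalkerSolution_iff hs).2 ⟨?_, ?_, fun q hq => ?_⟩
  · rw [forestProb, twoForestsThree, Set.inter_self, div_self hpos.ne']
  · have hempty : twoForestsThree G s₁ s₂ s₂ = ∅ :=
      Set.eq_empty_of_forall_notMem fun f hf => hf.2.2.2.2 .rfl
    simp [forestProb, hempty, totalWeight]
  · have hforest : forestProb G w s₁ s₂ = (totalWeight w (twoForests G s₁ s₂))⁻¹ •
        fun v => totalWeight w (twoForestsThree G s₁ v s₂) := by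
      ext v
      exact div_eq_inv_mul _ _
    rw [Set.mem_insert_iff, Set.mem_singleton_iff, not_or] at hq
    rw [hforest, Matrix.mulVec_smul, Pi.smul_apply, laplacian_mulVec_totalWeight G w hq.1 hq.2,
      smul_zero]

end Watershed

/-! ### First-step analysis of the random walk -/

theorem measurableSet_piNat_cylinder [MeasurableSpace V] [MeasurableSingletonClass V]
    (v : ℕ → V) (n : ℕ) : MeasurableSet (PiNat.cylinder v n) := by
  rw [PiNat.cylinder_eq_pi]
  exact .pi (Finset.countable_toSet _) fun i _ => measurableSet_singleton (v i)

theorem preimage_frestrictLe_singleton (v : ℕ → V) (n : ℕ) :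
    Preorder.frestrictLe (π := fun _ => V) n ⁻¹' {Preorder.frestrictLe n v} =
      PiNat.cylinder v (n + 1) := by
  ext ω
  simp [PiNat.cylinder, funext_iff]

theorem ext_of_piNat_cylinder [Countable V] [MeasurableSpace V] [MeasurableSingletonClass V]
    {μ ν : Measure (ℕ → V)} [IsFiniteMeasure μ]
    (h : ∀ v n, μ (PiNat.cylinder v (n + 1)) = ν (PiNat.cylinder v (n + 1))) : μ = ν := by
  have hμ : IsProjectiveMeasureFamily fun I : Finset ℕ => μ.map I.restrict :=
    isProjectiveMeasureFamily_map_restrict (X := fun (n : ℕ) (ω : ℕ → V) => ω n) (P := μ)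
      fun n => (measurable_pi_apply n).aemeasurable
  refine IsProjectiveLimit.unique (P := fun I => μ.map I.restrict) (fun _ => rfl) ?_
  refine (isProjectiveLimit_nat_iff hμ ν).2 fun n => Measure.ext_of_singleton fun p => ?_
  obtain ⟨v, rfl⟩ : ∃ v : ℕ → V, Preorder.frestrictLe n v = p :=
    ⟨fun i => p ⟨min i n, Finset.mem_Iic.2 (min_le_right i n)⟩, by
      ext ⟨i, hi⟩
      simp [min_eq_left (Finset.mem_Iic.1 hi)]⟩
  rw [← Preorder.frestrictLe, Measure.map_apply (by fun_prop) (measurableSet_singleton _),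
    Measure.map_apply (by fun_prop) (measurableSet_singleton _), preimage_frestrictLe_singleton, h]

/-- The trajectories that reach `s₁`, and do so before reaching `s₂`. -/
def hitsBefore (s₁ s₂ : V) : Set (ℕ → V) :=
  {ω | ∃ n, ω n = s₁ ∧ ∀ m ≤ n, ω m ≠ s₂}

theorem measurableSet_hitsBefore [MeasurableSpace V] [MeasurableSingletonClass V] (s₁ s₂ : V) :
    MeasurableSet (hitsBefore s₁ s₂) := by
  unfold hitsBefore
  measurability

theorem shift_mem_hitsBefore_iff {s₁ s₂ : V} {ω : ℕ → V} (h₁ : ω 0 ≠ s₁) (h₂ : ω 0 ≠ s₂) :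
    (fun n => ω (n + 1)) ∈ hitsBefore s₁ s₂ ↔ ω ∈ hitsBefore s₁ s₂ := by
  constructor
  · rintro ⟨n, hn, hlt⟩
    refine ⟨n + 1, hn, fun m hm => ?_⟩
    cases m with
    | zero => exact h₂
    | succ m => exact hlt m (Nat.le_of_succ_le_succ hm)
  · rintro ⟨_ | n, hn, hlt⟩
    · exact absurd hn h₁
    · exact ⟨n, hn, fun m hm => hlt (m + 1) (Nat.succ_le_succ hm)⟩

section Walk

variable [Fintype V] [MeasurableSpace V] [MeasurableSingletonClass V]
  (G : SimpleGraph V) (w : Sym2 V → ℝ)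

instance (q : V) : IsProbabilityMeasure (walkLaw G w q) := by
  unfold walkLaw
  infer_instance

theorem map_frestrictLe_zero_walkLaw (q : V) :
    (walkLaw G w q).map (Preorder.frestrictLe 0) = Measure.dirac fun _ => q := by
  rw [walkLaw, Kernel.traj_map_frestrictLe_apply, Kernel.partialTraj_self, Kernel.id_apply]

theorem map_frestrictLe_prod_walkLaw (q : V) (n : ℕ) :
    (walkLaw G w q).map (fun ω => (Preorder.frestrictLe n ω, ω (n + 1))) =
      (walkLaw G w q).map (Preorder.frestrictLe n) ⊗ₘ stepKernel G w n := by
  rw [walkLaw, Kernel.traj_map_frestrictLe_apply,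
    Kernel.partialTraj_compProd_eq_map_traj (X := fun _ => V) (Nat.zero_le n)]

theorem ae_walkLaw_zero (q : V) : ∀ᵐ ω ∂walkLaw G w q, ω 0 = q := by
  have h : ∀ᵐ p ∂(walkLaw G w q).map (Preorder.frestrictLe 0),
      p ⟨0, Finset.mem_Iic.2 le_rfl⟩ = q := by
    rw [map_frestrictLe_zero_walkLaw, ae_dirac_eq]
    rfl
  exact ae_of_ae_map (by fun_prop) h

theorem walkLaw_cylinder_succ (q : V) (v : ℕ → V) (n : ℕ) :
    walkLaw G w q (PiNat.cylinder v (n + 2)) =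
      stepPMF G w (v n) (v (n + 1)) * walkLaw G w q (PiNat.cylinder v (n + 1)) := by
  have hnext : (fun ω : ℕ → V => (Preorder.frestrictLe (π := fun _ => V) n ω, ω (n + 1))) ⁻¹'
      ({Preorder.frestrictLe n v} ×ˢ {v (n + 1)}) = PiNat.cylinder v (n + 2) := by
    ext ω
    rw [Set.mk_preimage_prod, preimage_frestrictLe_singleton]
    exact Nat.forall_lt_succ_right.symm
  rw [← hnext, ← Measure.map_apply (by fun_prop) (by measurability), map_frestrictLe_prod_walkLaw,
    Measure.compProd_apply_prod (by measurability) (by measurability), lintegral_singleton,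
    Measure.map_apply (by fun_prop) (measurableSet_singleton _), preimage_frestrictLe_singleton]
  congr 1
  exact PMF.toMeasure_apply_singleton _ _ (measurableSet_singleton _)

theorem walkLaw_cylinder (q : V) (v : ℕ → V) (n : ℕ) :
    walkLaw G w q (PiNat.cylinder v (n + 1)) =
      PMF.pure q (v 0) * ∏ i ∈ Finset.range n, stepPMF G w (v i) (v (i + 1)) := by
  classical
  induction n with
  | zero =>
    have h : PiNat.cylinder v 1 =ᵐ[walkLaw G w q] {_ω | v 0 = q} := by
      filter_upwards [ae_walkLaw_zero G w q] with ω hω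
      refine propext (Nat.forall_lt_succ_left.trans ((and_iff_left (by simp)).trans ?_))
      rw [hω]
      exact eq_comm
    rw [measure_congr h]
    by_cases hv : v 0 = q <;> simp [hv]
  | succ n ih =>
    rw [walkLaw_cylinder_succ, ih, Finset.prod_range_succ]
    ac_rfl

theorem walkLaw_map_shift (q : V) :
    (walkLaw G w q).map (fun ω n => ω (n + 1)) = ∑ k, stepPMF G w q k • walkLaw G w k := by
  classical
  refine ext_of_piNat_cylinder fun v n => ?_
  have hshift : (fun (ω : ℕ → V) n => ω (n + 1)) ⁻¹' PiNat.cylinder v (n + 1) =ᵐ[walkLaw G w q]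
      PiNat.cylinder (fun i => Nat.casesOn i q v) (n + 2) := by
    filter_upwards [ae_walkLaw_zero G w q] with ω hω
    refine propext (Iff.symm (Nat.forall_lt_succ_left.trans ?_))
    exact and_iff_right hω
  rw [Measure.map_apply (by fun_prop) (measurableSet_piNat_cylinder v _), measure_congr hshift,
    walkLaw_cylinder, Finset.prod_range_succ']
  simp [walkLaw_cylinder, PMF.pure_apply, mul_comm]

theorem hitProb_left {s₁ s₂ : V} (hs : s₁ ≠ s₂) : hitProb G w s₁ s₂ s₁ = 1 := by
  have h : ∀ᵐ ω ∂walkLaw G w s₁, ω ∈ hitsBefore s₁ s₂ := by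
    filter_upwards [ae_walkLaw_zero G w s₁] with ω hω
    exact ⟨0, hω, fun m hm => by rwa [Nat.le_zero.1 hm, hω]⟩
  exact (measureReal_congr (Filter.eventuallyEq_univ.2 h)).trans probReal_univ

theorem hitProb_right (s₁ s₂ : V) : hitProb G w s₁ s₂ s₂ = 0 := by
  rw [hitProb, measureReal_eq_zero_iff, measure_eq_zero_iff_ae_notMem]
  filter_upwards [ae_walkLaw_zero G w s₂] with ω hω ⟨n, _, hlt⟩
  exact hlt 0 n.zero_le hω

theorem hitProb_eq_sum {s₁ s₂ q : V} (h₁ : q ≠ s₁) (h₂ : q ≠ s₂) :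
    hitProb G w s₁ s₂ q = ∑ k, (stepPMF G w q k).toReal * hitProb G w s₁ s₂ k := by
  have hshift : hitsBefore s₁ s₂ =ᵐ[walkLaw G w q]
      (fun ω n => ω (n + 1)) ⁻¹' hitsBefore s₁ s₂ := by
    filter_upwards [ae_walkLaw_zero G w q] with ω hω
    exact propext (shift_mem_hitsBefore_iff (hω ▸ h₁) (hω ▸ h₂)).symm
  have hsum : walkLaw G w q (hitsBefore s₁ s₂) =
      ∑ k, stepPMF G w q k * walkLaw G w k (hitsBefore s₁ s₂) := by
    rw [measure_congr hshift, ← Measure.map_apply (by fun_prop) (measurableSet_hitsBefore s₁ s₂),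
      walkLaw_map_shift, Measure.finsetSum_apply]
    rfl
  have hfin (k : V) : stepPMF G w q k * walkLaw G w k (hitsBefore s₁ s₂) ≠ ∞ :=
    ENNReal.mul_ne_top (PMF.apply_ne_top _ k) (measure_ne_top _ _)
  calc hitProb G w s₁ s₂ q
      = (∑ k, stepPMF G w q k * walkLaw G w k (hitsBefore s₁ s₂)).toReal :=
        congrArg ENNReal.toReal hsum
    _ = ∑ k, (stepPMF G w q k).toReal * hitProb G w s₁ s₂ k := by
        simp only [ENNReal.toReal_sum fun k _ => hfin k, ENNReal.toReal_mul]
        rfl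

end Walk

section Harmonic

variable [Fintype V] {G : SimpleGraph V} {w : Sym2 V → ℝ}

theorem sum_pairWeight_pos (hG : G.Connected) (hw : ∀ e ∈ G.edgeSet, 0 < w e) {u v : V}
    (huv : u ≠ v) : 0 < ∑ k, pairWeight G w u k := by
  have : Nontrivial V := ⟨u, v, huv⟩
  obtain ⟨k, hk⟩ := hG.preconnected.exists_adj_of_nontrivial u
  have hpos : 0 < pairWeight G w u k := by
    rw [pairWeight, if_pos hk]
    exact hw _ hk
  exact Finset.sum_pos' (fun k _ => pairWeight_nonneg hw u k) ⟨k, Finset.mem_univ k, hpos⟩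

theorem stepPMF_toReal (hw : ∀ e ∈ G.edgeSet, 0 < w e) {u : V}
    (hu : 0 < ∑ j, pairWeight G w u j) (k : V) :
    (stepPMF G w u k).toReal = pairWeight G w u k / ∑ j, pairWeight G w u j := by
  have hsum : ∑' j, ENNReal.ofReal (pairWeight G w u j) =
      ENNReal.ofReal (∑ j, pairWeight G w u j) := by
    rw [tsum_fintype, ENNReal.ofReal_sum_of_nonneg fun j _ => pairWeight_nonneg hw u j]
  rw [stepPMF, dif_neg (hsum.trans_ne (ENNReal.ofReal_pos.2 hu).ne'), PMF.normalize_apply, hsum,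
    ENNReal.toReal_mul, ENNReal.toReal_inv, ENNReal.toReal_ofReal hu.le,
    ENNReal.toReal_ofReal (pairWeight_nonneg hw u k), div_eq_mul_inv]

theorem isRandomWalkerSolution_hitProb [MeasurableSpace V] [MeasurableSingletonClass V]
    (hG : G.Connected) (hw : ∀ e ∈ G.edgeSet, 0 < w e) {s₁ s₂ : V} (hs : s₁ ≠ s₂) :
    IsRandomWalkerSolution G w s₁ s₂ (hitProb G w s₁ s₂) := by
  refine (isRandomWalkerSolution_iff hs).2
    ⟨hitProb_left G w hs, hitProb_right G w s₁ s₂, fun q hq => ?_⟩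
  obtain ⟨h₁, h₂⟩ : q ≠ s₁ ∧ q ≠ s₂ := by simpa using hq
  have hdeg := sum_pairWeight_pos hG hw h₁
  have hstep : (∑ k, pairWeight G w q k) * hitProb G w s₁ s₂ q =
      ∑ k, pairWeight G w q k * hitProb G w s₁ s₂ k := by
    rw [hitProb_eq_sum G w h₁ h₂, Finset.mul_sum]
    refine Finset.sum_congr rfl fun k _ => ?_
    rw [stepPMF_toReal hw hdeg, ← mul_assoc, mul_div_cancel₀ _ hdeg.ne']
  simp only [laplacian_mulVec, mul_sub, Finset.sum_sub_distrib, ← Finset.sum_mul, hstep, sub_self]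

end Harmonic

end

end ProbWatershed

theorem theorem4p1_general {V : Type*} [Fintype V] [MeasurableSpace V] [MeasurableSingletonClass V]
    (G : SimpleGraph V) (hG : G.Connected) (w : Sym2 V → ℝ) (hw : ∀ e ∈ G.edgeSet, 0 < w e)
    (s₁ s₂ : V) (hs : s₁ ≠ s₂) :
    (∀ q : V, ProbWatershed.hitProb G w s₁ s₂ q = ProbWatershed.forestProb G w s₁ s₂ q) ∧
    (∀ x : V → ℝ, ProbWatershed.IsRandomWalkerSolution G w s₁ s₂ x ↔
      ∀ q : V, x q = ProbWatershed.forestProb G w s₁ s₂ q) := by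
  have hforest := ProbWatershed.isRandomWalkerSolution_forestProb hG hw hs
  have hwalk := ProbWatershed.isRandomWalkerSolution_hitProb hG hw hs
  refine ⟨congrFun (hwalk.unique hG hw hs hforest), fun x => ?_⟩
  refine ⟨fun hx => congrFun (hx.unique hG hw hs hforest), fun hx => ?_⟩
  rwa [funext hx]

/-- On a finite connected graph with edge weights `exp(-μ c(e))` and distinct seeds `s₁`, `s₂`, the
Random Walker probability of every node equals its Probabilistic Watershed probability, both for
the hitting probability of the walk and for the (unique) solution of the Random Walker's linear
system. -/
theorem theorem4p1 {V : Type*} [Fintype V] [MeasurableSpace V] [MeasurableSingletonClass V]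
    (G : SimpleGraph V) (hG : G.Connected) (c : Sym2 V → ℝ) (μ : ℝ) (hμ : 0 ≤ μ)
    (s₁ s₂ : V) (hs : s₁ ≠ s₂) :
    (∀ q : V, ProbWatershed.hitProb G (ProbWatershed.edgeWeight c μ) s₁ s₂ q =
      ProbWatershed.watershedProb G c μ s₁ s₂ q) ∧
    (∀ x : V → ℝ,
      ProbWatershed.IsRandomWalkerSolution G (ProbWatershed.edgeWeight c μ) s₁ s₂ x ↔
        ∀ q : V, x q = ProbWatershed.watershedProb G c μ s₁ s₂ q) := by
  simpa only [ProbWatershed.watershedProb_eq_forestProb] using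
    theorem4p1_general G hG (ProbWatershed.edgeWeight c μ) (fun _ _ => Real.exp_pos _) s₁ s₂ hs
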